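/- Let $\Lambda\subset\mathbb C$ be a period lattice with Weierstrass functions $\sigma,\wp$, and put $\Phi_x^y=\Phi_x(y)=\dfrac{\sigma(x+y)}{\sigma(x)\sigma(y)}$. Let $a,b,c\in\mathbb C$ be such that $a,b,c,a+b,b+c,c+a\notin\Lambda$ and $\wp(a),\wp(b),\wp(c)\neq0$, and put $$A=\frac{\wp(b)\wp(c)}{\wp(a)(\Phi_b^c)^2},\qquad B=\frac{\wp(c)\wp(a)}{\wp(b)(\Phi_c^a)^2},\qquad C=\frac{\wp(a)\wp(b)}{\wp(c)(\Phi_a^b)^2}.$$ For a function $\tau=\tau(n,m,l)$ on $\mathbb Z^3$ write $\tilde\tau,\hat\tau,\bar\tau$ for its shifts $n\mapsto n+1$, $m\mapsto m+1$, $l\mapsto l+1$, and combine accents for combined shifts. (0) The square roots $A^{1/2},B^{1/2},C^{1/2}$ can be chosen so that $$A^{1/2}B^{1/2}=\frac{\wp(c)}{\Phi_b^c\Phi_c^a},\qquad B^{1/2}C^{1/2}=\frac{\wp(a)}{\Phi_c^a\Phi_a^b},\qquad C^{1/2}A^{1/2}=\frac{\wp(b)}{\Phi_a^b\Phi_b^c}.$$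 Fix any such choice; half-integer powers of $A,B,C$ below are the integer powers of these square roots. (1) If $\tau=A^{\frac{ml}2}B^{\frac{nl}2}C^{\frac{nm}2}f$ on $\mathbb Z^3$, then, at every $(n,m,l)\in\mathbb Z^3$, the dBKP equation with elliptic coefficients $$\Phi_a^{-b}\Phi_b^{-c}\Phi_c^{-a}\,\tilde{\hat{\bar\tau}}\,\tau+\Phi_a^{-b}\wp(c)\,\tilde{\hat\tau}\,\bar\tau+\Phi_b^{-c}\wp(a)\,\hat{\bar\tau}\,\tilde\tau+\Phi_c^{-a}\wp(b)\,\tilde{\bar\tau}\,\hat\tau=0$$ holds for $\tau$ if and only if the dBKP equation $$\Phi_a^{-b}\Phi_b^{-c}\Phi_c^{-a}\,\tilde{\hat{\bar f}}\,f+\Phi_a^{-b}\Phi_b^{c}\Phi_c^{a}\,\tilde{\hat f}\,\bar f+\Phi_b^{-c}\Phi_a^{b}\Phi_c^{a}\,\hat{\bar f}\,\tilde f+\Phi_c^{-a}\Phi_a^{b}\Phi_b^{c}\,\tilde{\bar f}\,\hat f=0\qquad(*)$$ holds for $f$. (2) Let $N\ge0$, $\xi_0\in\mathbb C$, $\rho_1,\dots,\rho_N\in\mathbb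 C$, and let $\kappa_1,\dots,\kappa_N\in\mathbb C$ satisfy $\kappa_i\notin\Lambda$, $\kappa_i+\kappa_j\notin\Lambda$ and $a\pm\kappa_i,\,b\pm\kappa_i,\,c\pm\kappa_i\notin\Lambda$ for all $i,j$ (including $i=j$). Put $\xi=an+bm+cl+\xi_0$ and let $\mathcal M$ be the $N\times N$ matrix $\mathcal M_{ij}=S_i\,\Phi_\xi(\kappa_i+\kappa_j)\,T_j$ with $$S_i=\Phi_a(-\kappa_i)^n\,\Phi_b(-\kappa_i)^m\,\Phi_c(-\kappa_i)^l\,\rho_i,\qquad T_j=\Phi_a(\kappa_j)^{-n}\,\Phi_b(\kappa_j)^{-m}\,\Phi_c(\kappa_j)^{-l}\,\rho_j.$$ Then $$f=A^{-\frac{ml}2}B^{-\frac{nl}2}C^{-\frac{nm}2}\,\sigma(\xi)\,\det(I+\mathcal M)$$ satisfies $(*)$ at every $(n,m,l)\in\mathbb Z^3$ for which $\xi\notin\Lambda$ at all eight points $(n+i,m+j,l+k)$, $i,j,k\in\{0,1\}$. In particular it solves $(*)$ on all of $\mathbb Z^3$ if $\xi\notin\Lambda$ everywhere. -/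

import Mathlib

open scoped PeriodPair

noncomputable section

namespace EllipticBKP

/-- The Weierstrass sigma function of the period lattice `Λ` of `L`,
`σ(z) = z ∏_{ω ∈ Λ \ {0}} (1 - z / ω) exp (z / ω + (z / ω) ^ 2 / 2)`.
The factor at `ω = 0` is equal to `1`, since `z / 0 = 0`. -/
def sigma (L : PeriodPair) (z : ℂ) : ℂ :=
  z * ∏' ω : L.lattice, (1 - z / ω) * Complex.exp (z / ω + (z / ω) ^ 2 / 2)

theorem norm_sigmaFactor_sub_one_le (z:ℂ)(hz : ‖z‖ ≤ 1/2): ‖(1-z)*Complex.exp (z+z^2/2) - 1‖ ≤ 20*‖z‖^3 := by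
  have hz0 := norm_nonneg z
  have hu : ‖z+z^2/2‖ ≤ 2*‖z‖ := by
    calc _ ≤ ‖z‖ + ‖z^2/2‖ := norm_add_le _ _
      _ = ‖z‖ + ‖z‖^2/2 := by simp
      _ ≤ _ := by nlinarith
  have e : (1-z)*Complex.exp (z+z^2/2) - 1 = (1-z)*(Complex.exp (z+z^2/2) - (1+(z+z^2/2)+(z+z^2/2)^2/2)) + z^3*(-1/2 - 3/8*z - z^2/8) := by
    ring
  have h3 := Complex.exp_bound (x := z+z^2/2) (by linarith) (n:=3) (by norm_num)
  simp only [Finset.sum_range_succ, Nat.factorial] at h3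
  norm_num at h3
  rw [e]
  have h4 : ‖(1-z)‖ ≤ 3/2 := (norm_sub_le _ _).trans (by simp; linarith)
  have h5 : ‖(-1/2 - 3/8*z - z^2/8 : ℂ)‖ ≤ 1 := by
    refine (norm_sub_le _ _).trans ?_
    have := norm_sub_le (-1/2 : ℂ) (3/8*z)
    norm_num at this ⊢
    nlinarith
  have h6 : ‖z+z^2/2‖^3 ≤ 8*‖z‖^3 := (pow_le_pow_left₀ (norm_nonneg _) hu 3).trans (by ring_nf; rfl)
  refine (norm_add_le _ _).trans ?_
  rw [norm_mul, norm_mul, norm_pow]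
  have h7 := mul_le_mul h4 h3 (norm_nonneg _) (by norm_num)
  have h8 := mul_le_mul_of_nonneg_left h5 (pow_nonneg hz0 3)
  nlinarith [pow_nonneg hz0 3]

/-- The product defining `σ` converges unconditionally. -/
theorem multipliable_sigmaFactor (L : PeriodPair) (z : ℂ) :
    Multipliable fun ω : L.lattice ↦ (1 - z / ω) * Complex.exp (z / ω + (z / ω) ^ 2 / 2) := by
  have hs : Summable fun ω : L.lattice ↦ 20 * ‖z‖^3 * ‖ω‖ ^ (-3 : ℝ) :=
    (ZLattice.summable_norm_rpow _ _ (by simp; norm_num)).mul_left _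
  have := Complex.multipliable_one_add_of_summable (f := fun ω : L.lattice ↦ (1 - z / ω) * Complex.exp (z / ω + (z / ω) ^ 2 / 2) - 1) ?_
  · simpa using this
  refine Summable.of_norm_bounded_eventually (hs) ?_
  refine (isCompact_iff_finite.mp (isCompact_closedBall (0 : L.lattice) (2*‖z‖))).subset ?_
  intro ω hω
  simp only [Metric.mem_closedBall, dist_zero_right]
  contrapose! hω
  have h0 : 0 < ‖(ω:ℂ)‖ := lt_of_le_of_lt (by positivity) hω
  have h1 : 2*‖z‖ < ‖(ω:ℂ)‖ := hω
  have := norm_sigmaFactor_sub_one_le (z/ω) (by rw [norm_div, div_le_iff₀ h0]; linarith)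
  change ¬ ¬ _
  rw [not_not]
  refine this.trans (le_of_eq ?_)
  rw [norm_div, div_pow, show ‖ω‖ = ‖(ω:ℂ)‖ from rfl, Real.rpow_neg h0.le]
  norm_cast
  ring

/-- The function `Φ_x^y = Φ_x(y) = σ(x + y) / (σ(x) σ(y))`. -/
def Phi (L : PeriodPair) (x y : ℂ) : ℂ :=
  sigma L (x + y) / (sigma L x * sigma L y)

/-- The left-hand side, at the lattice site `(n, m, l)`, of the dBKP equation with coefficients
`Φ_a^{-b} Φ_b^{-c} Φ_c^{-a}`, `Φ_a^{-b} ℘(c)`, `Φ_b^{-c} ℘(a)`, `Φ_c^{-a} ℘(b)`. -/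
def dBKPWp (L : PeriodPair) (a b c : ℂ) (τ : ℤ → ℤ → ℤ → ℂ) (n m l : ℤ) : ℂ :=
  Phi L a (-b) * Phi L b (-c) * Phi L c (-a) * (τ (n + 1) (m + 1) (l + 1) * τ n m l)
    + Phi L a (-b) * ℘[L] c * (τ (n + 1) (m + 1) l * τ n m (l + 1))
    + Phi L b (-c) * ℘[L] a * (τ n (m + 1) (l + 1) * τ (n + 1) m l)
    + Phi L c (-a) * ℘[L] b * (τ (n + 1) m (l + 1) * τ n (m + 1) l)

/-- The left-hand side, at the lattice site `(n, m, l)`, of the dBKP equation all of whose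
coefficients are products of three values of `Φ`. -/
def dBKPPhi (L : PeriodPair) (a b c : ℂ) (f : ℤ → ℤ → ℤ → ℂ) (n m l : ℤ) : ℂ :=
  Phi L a (-b) * Phi L b (-c) * Phi L c (-a) * (f (n + 1) (m + 1) (l + 1) * f n m l)
    + Phi L a (-b) * Phi L b c * Phi L c a * (f (n + 1) (m + 1) l * f n m (l + 1))
    + Phi L b (-c) * Phi L a b * Phi L c a * (f n (m + 1) (l + 1) * f (n + 1) m l)
    + Phi L c (-a) * Phi L a b * Phi L b c * (f (n + 1) m (l + 1) * f n (m + 1) l)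

/-- `A = ℘(b) ℘(c) / (℘(a) (Φ_b^c)²)`. -/
def gaugeA (L : PeriodPair) (a b c : ℂ) : ℂ := ℘[L] b * ℘[L] c / (℘[L] a * Phi L b c ^ 2)

/-- `B = ℘(c) ℘(a) / (℘(b) (Φ_c^a)²)`. -/
def gaugeB (L : PeriodPair) (a b c : ℂ) : ℂ := ℘[L] c * ℘[L] a / (℘[L] b * Phi L c a ^ 2)

/-- `C = ℘(a) ℘(b) / (℘(c) (Φ_a^b)²)`. -/
def gaugeC (L : PeriodPair) (a b c : ℂ) : ℂ := ℘[L] a * ℘[L] b / (℘[L] c * Phi L a b ^ 2)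

/-- `α`, `β`, `γ` are a determination of `A^{1/2}`, `B^{1/2}`, `C^{1/2}` with matched signs:
`A^{1/2} B^{1/2}`, `B^{1/2} C^{1/2}`, `C^{1/2} A^{1/2}` (the squares of which are perfect squares)
are the roots `℘(c) / (Φ_b^c Φ_c^a)`, `℘(a) / (Φ_c^a Φ_a^b)`, `℘(b) / (Φ_a^b Φ_b^c)`. -/
structure IsGaugeRoots (L : PeriodPair) (a b c α β γ : ℂ) : Prop where
  sq_left : α ^ 2 = gaugeA L a b c
  sq_mid : β ^ 2 = gaugeB L a b c
  sq_right : γ ^ 2 = gaugeC L a b c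
  left_mul_mid : α * β = ℘[L] c / (Phi L b c * Phi L c a)
  mid_mul_right : β * γ = ℘[L] a / (Phi L c a * Phi L a b)
  right_mul_left : γ * α = ℘[L] b / (Phi L a b * Phi L b c)

/-- `ξ = a n + b m + c l + ξ₀`. -/
def xi (a b c ξ₀ : ℂ) (n m l : ℤ) : ℂ := a * n + b * m + c * l + ξ₀

/-- The matrix `𝓜_{ij} = S_i Φ_ξ(κ_i + κ_j) T_j`, with
`S_i = Φ_a(-κ_i)^n Φ_b(-κ_i)^m Φ_c(-κ_i)^l ρ_i` and
`T_j = Φ_a(κ_j)^{-n} Φ_b(κ_j)^{-m} Φ_c(κ_j)^{-l} ρ_j`. -/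
def cauchyMatrix (L : PeriodPair) (a b c ξ₀ : ℂ) {N : ℕ} (κ ρ : Fin N → ℂ) (n m l : ℤ) :
    Matrix (Fin N) (Fin N) ℂ :=
  Matrix.of fun i j =>
    (Phi L a (-κ i) ^ n * Phi L b (-κ i) ^ m * Phi L c (-κ i) ^ l * ρ i)
      * Phi L (xi a b c ξ₀ n m l) (κ i + κ j)
      * (Phi L a (κ j) ^ (-n) * Phi L b (κ j) ^ (-m) * Phi L c (κ j) ^ (-l) * ρ j)

/-- The function `σ(ξ) det(I + 𝓜)`. -/
def ellipticTau (L : PeriodPair) (a b c ξ₀ : ℂ) {N : ℕ} (κ ρ : Fin N → ℂ) (n m l : ℤ) : ℂ :=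
  sigma L (xi a b c ξ₀ n m l) * (1 + cauchyMatrix L a b c ξ₀ κ ρ n m l).det

end EllipticBKP

end

/-! Part (1) is a count of exponents: the root relations express `℘(a)`, `℘(b)`, `℘(c)` through
products of roots and values of `Phi`, so all four terms acquire one common nonzero factor
(`IsGaugeRoots.dBKPWp_eq_zero_iff`). Part (2) thereby reduces to showing that `ellipticTau` solves
the equation with `℘` coefficients.

Only the products `S_i T_i` enter the determinant, and a lattice step by `a` multiplies them by
`σ(κ_i - a) / σ(κ_i + a)`. The three-term identity of Weierstrass says that a Schur complement of
the kernel `Φ_ξ(p + q)` is the same kernel at `ξ + x + y`, up to row and column factors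
(`Phi_exchange`). Bordering the matrix with parameters `x`, `y` therefore realises the shift by `x`
and `y` (`det_borderedCauchy`), and the Desnanot–Jacobi identity becomes a bilinear relation between
shifts (`solitonTau_bilinear`). Its three cyclic versions combine linearly into the required
equation (`dBKP_of_bilinear`).

The facts on `σ` come from its product: quasi-periodicity by reindexing, the formula for `σ(x + y)
σ(x - y)` by Liouville, and the three-term identity from that formula by density. -/

noncomputable section

namespace EllipticBKP

/-! ### The sigma function: convergence, zeros, quasi-periodicity. -/

section

open Filter Topology

/-- The Weierstrass primary factor of genus two, `E(t) = (1 - t) exp (t + t² / 2)`. -/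
def primaryFactor (t : ℂ) : ℂ := (1 - t) * Complex.exp (t + t ^ 2 / 2)

@[simp]
theorem primaryFactor_zero : primaryFactor 0 = 1 := by simp [primaryFactor]

theorem primaryFactor_ne_zero {t : ℂ} (ht : t ≠ 1) : primaryFactor t ≠ 0 :=
  mul_ne_zero (sub_ne_zero.mpr ht.symm) (Complex.exp_ne_zero _)

variable (L : PeriodPair)

/-- The product `∏ E(z / ω)` over the lattice, so that `σ(z) = z ∏ E(z / ω)`. -/
def sigmaProd (z : ℂ) : ℂ := ∏' ω : L.lattice, primaryFactor (z / ω)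

theorem sigma_eq (z : ℂ) : sigma L z = z * sigmaProd L z := rfl

theorem summable_norm_rpow_neg_three (C : ℝ) :
    Summable fun ω : L.lattice ↦ C * ‖ω‖ ^ (-3 : ℝ) :=
  (ZLattice.summable_norm_rpow _ _ (by simp; norm_num)).mul_left _

theorem norm_rpow_neg_three (ω : L.lattice) : ‖ω‖ ^ (-3 : ℝ) = (‖(ω : ℂ)‖ ^ 3)⁻¹ := by
  rw [Real.rpow_neg (norm_nonneg _), show (3 : ℝ) = ((3 : ℕ) : ℝ) by norm_num,
    Real.rpow_natCast]
  rfl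

theorem eventually_cofinite_lt_norm (R : ℝ) : ∀ᶠ ω : L.lattice in cofinite, R < ‖(ω : ℂ)‖ := by
  refine (isCompact_iff_finite.mp (isCompact_closedBall (0 : L.lattice) R)).subset ?_
  intro ω hω
  simp only [Metric.mem_closedBall, dist_zero_right]
  simpa using hω

/-- Since `E(t) = 1 + O(t³)`, the terms are dominated by the summable `‖ω‖⁻³`; uniformity on balls
makes the product entire. -/
theorem eventually_norm_primaryFactor_sub_one_le (R : ℝ) (hR : 0 ≤ R) :
    ∀ᶠ ω : L.lattice in cofinite, ∀ z ∈ Metric.closedBall (0 : ℂ) R,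
      ‖primaryFactor (z / ω) - 1‖ ≤ 20 * R ^ 3 * ‖ω‖ ^ (-3 : ℝ) := by
  filter_upwards [eventually_cofinite_lt_norm L (2 * R)] with ω hω z hz
  have hz : ‖z‖ ≤ R := by simpa using hz
  have h0 : 0 < ‖(ω : ℂ)‖ := lt_of_le_of_lt (by positivity) hω
  have := norm_sigmaFactor_sub_one_le (z / ω) (by rw [norm_div, div_le_iff₀ h0]; linarith)
  refine this.trans ?_
  have h1 : ‖z‖ ^ 3 ≤ R ^ 3 := pow_le_pow_left₀ (norm_nonneg _) hz 3
  rw [norm_div, div_pow, norm_rpow_neg_three, div_eq_mul_inv, mul_assoc]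
  gcongr

theorem summable_norm_primaryFactor_sub_one (z : ℂ) :
    Summable fun ω : L.lattice ↦ ‖primaryFactor (z / ω) - 1‖ := by
  refine Summable.of_norm_bounded_eventually
    (summable_norm_rpow_neg_three L (20 * ‖z‖ ^ 3)) ?_
  filter_upwards [eventually_norm_primaryFactor_sub_one_le L ‖z‖ (norm_nonneg _)] with ω hω
  simpa using hω z (by simp)

theorem multipliable_primaryFactor (z : ℂ) :
    Multipliable fun ω : L.lattice ↦ primaryFactor (z / ω) :=
  multipliable_sigmaFactor L z

theorem primaryFactor_div_ne_zero {z : ℂ} (hz : z ∉ L.lattice) (ω : L.lattice) :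
    primaryFactor (z / ω) ≠ 0 := by
  refine primaryFactor_ne_zero fun h ↦ hz ?_
  have h0 : (ω : ℂ) ≠ 0 := by
    intro h0
    simp [h0] at h
  rw [div_eq_one_iff_eq h0] at h
  exact h ▸ ω.2

theorem sigmaProd_ne_zero {z : ℂ} (hz : z ∉ L.lattice) : sigmaProd L z ≠ 0 := by
  have := tprod_one_add_ne_zero_of_summable (f := fun ω : L.lattice ↦ primaryFactor (z / ω) - 1)
    (fun ω ↦ by simpa using primaryFactor_div_ne_zero L hz ω)
    (summable_norm_primaryFactor_sub_one L z)
  simpa [sigmaProd] using this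

@[simp]
theorem sigmaProd_zero : sigmaProd L 0 = 1 := by simp [sigmaProd]

theorem sigma_ne_zero {z : ℂ} (hz : z ∉ L.lattice) : sigma L z ≠ 0 :=
  mul_ne_zero (fun h ↦ hz (h ▸ zero_mem _)) (sigmaProd_ne_zero L hz)

theorem sigma_eq_zero_of_mem {z : ℂ} (hz : z ∈ L.lattice) : sigma L z = 0 := by
  rw [sigma_eq]
  by_cases h0 : z = 0
  · simp [h0]
  · rw [sigmaProd, tprod_of_exists_eq_zero ⟨⟨z, hz⟩, by simp [h0, primaryFactor]⟩, mul_zero]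

@[simp]
theorem sigma_zero : sigma L 0 = 0 := sigma_eq_zero_of_mem L (zero_mem _)

theorem sigmaProd_neg (z : ℂ) : sigmaProd L (-z) = sigmaProd L z := by
  rw [sigmaProd, ← (Equiv.neg L.lattice).tprod_eq]
  simp [sigmaProd]

@[simp]
theorem sigma_neg (z : ℂ) : sigma L (-z) = -sigma L z := by
  rw [sigma_eq, sigma_eq, sigmaProd_neg, neg_mul]

theorem differentiable_primaryFactor_div (ω : L.lattice) :
    Differentiable ℂ fun z : ℂ ↦ primaryFactor (z / ω) := by
  unfold primaryFactor
  fun_prop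

theorem differentiable_sigmaProd : Differentiable ℂ (sigmaProd L) := by
  rw [← differentiableOn_univ]
  have key : HasProdLocallyUniformlyOn
      (fun (ω : L.lattice) (z : ℂ) ↦ 1 + (primaryFactor (z / ω) - 1))
      (fun z ↦ ∏' ω : L.lattice, (1 + (primaryFactor (z / ω) - 1))) Set.univ := by
    refine hasProdLocallyUniformlyOn_of_forall_compact isOpen_univ fun K _ hK ↦ ?_
    obtain ⟨R, hR⟩ := hK.isBounded.subset_closedBall (0 : ℂ)
    refine Summable.hasProdUniformlyOn_one_add hK
      (summable_norm_rpow_neg_three L (20 * (max R 0) ^ 3)) ?_ fun ω ↦ ?_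
    · filter_upwards [eventually_norm_primaryFactor_sub_one_le L (max R 0) (le_max_right _ _)]
        with ω hω z hz
      exact hω z (Metric.closedBall_subset_closedBall (le_max_left _ _) (hR hz))
    · exact ((differentiable_primaryFactor_div L ω).sub_const 1).continuous.continuousOn
  have := key.differentiableOn (.of_forall fun s ↦ ?_) isOpen_univ
  · simpa [sigmaProd, Function.comp_def] using! this
  · refine DifferentiableOn.fun_finsetProd fun ω _ ↦ ?_
    exact (((differentiable_primaryFactor_div L ω).sub_const 1).const_add 1).differentiableOn

theorem differentiable_sigma : Differentiable ℂ (sigma L) :=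
  differentiable_id.mul (differentiable_sigmaProd L)

theorem continuous_sigma : Continuous (sigma L) := (differentiable_sigma L).continuous

/-- The coefficient of `z` in the exponent of `E((z + ω₀) / (ω + ω₀)) / E(z / ω)`. -/
def shiftLinearCoeff (ω₀ ω : L.lattice) : ℂ :=
  1 / (ω + ω₀) + ω₀ / (ω + ω₀) ^ 2 - 1 / ω

theorem summable_shiftLinearCoeff (ω₀ : L.lattice) : Summable (shiftLinearCoeff L ω₀) := by
  refine Summable.of_norm_bounded_eventually
    (summable_norm_rpow_neg_three L (4 * ‖(ω₀ : ℂ)‖ ^ 2)) ?_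
  filter_upwards [eventually_cofinite_lt_norm L (2 * ‖(ω₀ : ℂ)‖)] with ω hω
  have h0 : 0 < ‖(ω : ℂ)‖ := lt_of_le_of_lt (by positivity) hω
  have h1 : ‖(ω : ℂ)‖ / 2 ≤ ‖(ω + ω₀ : ℂ)‖ := by
    have := norm_sub_le (ω + ω₀ : ℂ) ω₀
    rw [add_sub_cancel_right] at this
    linarith
  have h2 : (ω : ℂ) ≠ 0 := norm_pos_iff.mp h0
  have h3 : (ω + ω₀ : ℂ) ≠ 0 := norm_pos_iff.mp (by linarith)
  -- The terms of order `1/ω` and `1/ω²` cancel, which leaves cubic decay.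
  have e : shiftLinearCoeff L ω₀ ω = -(ω₀ : ℂ) ^ 2 / (ω * (ω + ω₀) ^ 2) := by
    unfold shiftLinearCoeff
    field_simp
    ring
  rw [e, norm_div, norm_neg, norm_pow, norm_mul, norm_pow, norm_rpow_neg_three,
    div_le_iff₀ (mul_pos h0 (pow_pos (norm_pos_iff.mpr h3) 2))]
  have h4 : (‖(ω : ℂ)‖ / 2) ^ 2 ≤ ‖(ω + ω₀ : ℂ)‖ ^ 2 := pow_le_pow_left₀ (by positivity) h1 2
  calc ‖(ω₀ : ℂ)‖ ^ 2 = 4 * ‖(ω₀ : ℂ)‖ ^ 2 * (‖(ω : ℂ)‖ ^ 3)⁻¹ *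
        (‖(ω : ℂ)‖ * (‖(ω : ℂ)‖ / 2) ^ 2) := by field_simp; ring
    _ ≤ _ := by gcongr

/-- This is the series of `℘` at the lattice point `ω₀`, where `1 / 0 = 0` and the value of `℘` is
`0`. It removes any Gaussian factor from the quasi-periodicity of `σ`. -/
theorem hasSum_shiftQuadraticCoeff (ω₀ : L.lattice) :
    HasSum (fun ω : L.lattice ↦ (1 / (ω + ω₀ : ℂ) ^ 2 - 1 / (ω : ℂ) ^ 2) / 2) 0 := by
  have := (L.hasSum_weierstrassP ω₀)
  rw [L.weierstrassP_coe, ← (Equiv.neg L.lattice).hasSum_iff] at this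
  simpa [Function.comp_def, add_comm] using this.div_const 2

/-- The constant factor in `E((z + ω₀) / (ω + ω₀)) / E(z / ω)`. -/
def shiftConst (ω₀ ω : L.lattice) : ℂ :=
  -- The generic value at `ω = 0` would be `E(1) = 0`.
  if ω = 0 then 1 else primaryFactor (ω₀ / (ω + ω₀ : ℂ))

theorem multipliable_shiftConst (ω₀ : L.lattice) : Multipliable (shiftConst L ω₀) := by
  have h1 := (Equiv.addRight ω₀).summable_iff.mpr
    (summable_norm_primaryFactor_sub_one L ω₀).of_norm
  have h2 : Summable fun ω : L.lattice ↦ shiftConst L ω₀ ω - 1 := by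
    refine h1.congr_cofinite ?_
    filter_upwards [eventually_cofinite_ne (0 : L.lattice)] with ω hω
    simp [shiftConst, hω]
  simpa using Complex.multipliable_one_add_of_summable h2

/-- The factor by which the lattice points `0` and `-ω₀` deviate from the generic form of
`E((z + ω₀) / (ω + ω₀)) / E(z / ω)`. -/
def shiftDefect (ω₀ : L.lattice) (z : ℂ) (ω : L.lattice) : ℂ :=
  if ω = 0 then -z / ω₀ * Complex.exp (3 / 2) else if ω = -ω₀ then ω₀ / (z + ω₀) else 1

/-- For generic `ω` both factors vanish only at `z = ω`, so their ratio is the exponential of a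
quadratic polynomial. At `ω = 0` and `ω = -ω₀` one of the two is `1` by division by zero, which
`shiftDefect` corrects; its `3 / 2` is `t + t² / 2` at `t = 1`. -/
theorem primaryFactor_shift (ω₀ : L.lattice) (h₀ : ω₀ ≠ 0) {z : ℂ} (hz : z ∉ L.lattice)
    (ω : L.lattice) :
    primaryFactor ((z + ω₀) / ((ω + ω₀ : L.lattice) : ℂ)) =
      primaryFactor (z / ω) * (shiftConst L ω₀ ω *
        Complex.exp (shiftLinearCoeff L ω₀ ω * z +
          (1 / (ω + ω₀ : ℂ) ^ 2 - 1 / (ω : ℂ) ^ 2) / 2 * z ^ 2) * shiftDefect L ω₀ z ω) := by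
  have h₀' : (ω₀ : ℂ) ≠ 0 := by simpa using h₀
  by_cases h1 : ω = 0
  · subst h1
    simp only [shiftConst, shiftLinearCoeff, shiftDefect, primaryFactor, if_true]
    simp only [ZeroMemClass.coe_zero, zero_add, div_zero]
    simp only [sub_zero, Complex.exp_zero, mul_one, one_mul, ne_eq, OfNat.ofNat_ne_zero,
      not_false_eq_true, zero_pow, zero_div]
    rw [mul_left_comm, ← Complex.exp_add]
    congr 1
    · field_simp; ring
    · congr 1; field_simp; ring
  by_cases h2 : ω = -ω₀
  · subst h2
    have hz' : z + ω₀ ≠ 0 := by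
      intro h
      apply hz
      rw [eq_neg_of_add_eq_zero_left h]
      exact neg_mem ω₀.2
    simp only [shiftConst, shiftLinearCoeff, shiftDefect, primaryFactor, if_neg h1, if_true]
    simp only [neg_add_cancel, NegMemClass.coe_neg, ZeroMemClass.coe_zero, div_zero]
    simp only [sub_zero, Complex.exp_zero, mul_one, one_mul, ne_eq, OfNat.ofNat_ne_zero,
      not_false_eq_true, zero_pow, zero_div, add_zero, div_zero]
    rw [mul_assoc, ← mul_assoc (Complex.exp _), ← Complex.exp_add]
    rw [show (z / -(ω₀ : ℂ) + (z / -(ω₀ : ℂ)) ^ 2 / 2 + ((0 - 1 / -(ω₀ : ℂ)) * z +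
      (0 - 1 / (-(ω₀ : ℂ)) ^ 2) / 2 * z ^ 2)) = 0 by field_simp; ring]
    rw [Complex.exp_zero]
    field_simp
    ring
  · have h3 : (ω : ℂ) ≠ 0 := by simpa using h1
    have h4 : (ω + ω₀ : ℂ) ≠ 0 := by
      intro h
      exact h2 (eq_neg_of_add_eq_zero_left (Subtype.ext (by simpa using h)))
    simp only [shiftConst, shiftLinearCoeff, shiftDefect, primaryFactor, if_neg h1, if_neg h2,
      mul_one, Submodule.coe_add]
    rw [mul_assoc (1 - (ω₀ : ℂ) / _), ← Complex.exp_add, mul_mul_mul_comm, ← Complex.exp_add]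
    congr 1
    · field_simp; ring
    · congr 1; field_simp; ring

theorem exists_sigma_add_coe (ω₀ : L.lattice) :
    ∃ K A : ℂ, K ≠ 0 ∧ ∀ z, sigma L (z + ω₀) = K * Complex.exp (A * z) * sigma L z := by
  by_cases h₀ : ω₀ = 0
  · exact ⟨1, 0, one_ne_zero, by simp [h₀]⟩
  have h₀' : (ω₀ : ℂ) ≠ 0 := by simpa using h₀
  set K : ℂ := -Complex.exp (3 / 2) * ∏' ω, shiftConst L ω₀ ω with hK
  set A : ℂ := ∑' ω, shiftLinearCoeff L ω₀ ω with hA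
  have key : ∀ z ∉ L.lattice, sigma L (z + ω₀) = K * Complex.exp (A * z) * sigma L z := by
    intro z hz
    have hz' : z + ω₀ ≠ 0 := by
      intro h
      apply hz
      rw [eq_neg_of_add_eq_zero_left h]
      exact neg_mem ω₀.2
    have hexp := (((summable_shiftLinearCoeff L ω₀).hasSum.mul_right z).add
      ((hasSum_shiftQuadraticCoeff L ω₀).mul_right (z ^ 2))).cexp
    -- The two defects multiply to `-exp(3/2) z / (z + ω₀)`, which turns the prefactor `z + ω₀` of
    -- `σ(z + ω₀)` into the prefactor `z` of `σ(z)`.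
    have hdef : HasProd (shiftDefect L ω₀ z) (∏ ω ∈ {0, -ω₀}, shiftDefect L ω₀ z ω) := by
      refine hasProd_prod_of_ne_finset_one fun ω hω ↦ ?_
      simp only [Finset.mem_insert, Finset.mem_singleton, not_or] at hω
      simp [shiftDefect, hω.1, hω.2]
    rw [Finset.prod_pair (by simpa [eq_comm] using h₀)] at hdef
    have hprod := (multipliable_primaryFactor L z).hasProd.mul
      (((multipliable_shiftConst L ω₀).hasProd.mul hexp).mul hdef)
    have hshift := (tprod_congr fun ω ↦ primaryFactor_shift L ω₀ h₀ hz ω).trans hprod.tprod_eq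
    replace hshift := ((Equiv.addRight ω₀).tprod_eq
      fun ω : L.lattice ↦ primaryFactor ((z + ω₀) / ω)).symm.trans hshift
    change sigmaProd L (z + ω₀) = _ at hshift
    rw [sigma_eq, hshift, sigma_eq, hK, hA, sigmaProd]
    simp only [shiftDefect, if_true, neg_eq_zero, h₀, if_false, zero_mul, add_zero]
    field_simp
  refine ⟨K, A, ?_, fun z ↦ ?_⟩
  -- If `K = 0`, then `σ` would vanish at the translate by `ω₀` of a half period, which is not a
  -- lattice point.
  · intro h
    have h1 := L.ω₁_div_two_notMem_lattice
    have h2 := key _ h1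
    rw [h, zero_mul, zero_mul] at h2
    refine sigma_ne_zero L (fun h3 ↦ h1 ?_) h2
    simpa using sub_mem h3 ω₀.2
  · by_cases hz : z ∈ L.lattice
    · rw [sigma_eq_zero_of_mem L hz, sigma_eq_zero_of_mem L (add_mem hz ω₀.2), mul_zero]
    · exact key z hz

end

/-! ### Addition formulas for sigma. -/

section

open Filter Topology

variable (L : PeriodPair)

/-- An even entire function vanishing at the origin is divisible by `x ^ 2`. -/
theorem exists_eq_sq_mul_of_even {f : ℂ → ℂ} (hf : Differentiable ℂ f) (h0 : f 0 = 0)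
    (heven : ∀ x, f (-x) = f x) :
    ∃ k : ℂ → ℂ, Differentiable ℂ k ∧ ∀ x, f x = x ^ 2 * k x := by
  have h1 : Differentiable ℂ (dslope f 0) := by
    rw [← differentiableOn_univ] at hf ⊢
    exact (Complex.differentiableOn_dslope univ_mem).mpr hf
  have h2 : Differentiable ℂ (dslope (dslope f 0) 0) := by
    rw [← differentiableOn_univ] at h1 ⊢
    exact (Complex.differentiableOn_dslope univ_mem).mpr h1
  have h3 : dslope f 0 0 = 0 := by
    rw [dslope_same]
    have h := deriv_comp_neg f (0 : ℂ)
    simp only [heven, neg_zero] at h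
    exact self_eq_neg.mp h
  refine ⟨_, h2, fun x ↦ ?_⟩
  have e1 := sub_smul_dslope f 0 x
  have e2 := sub_smul_dslope (dslope f 0) 0 x
  simp only [sub_zero, smul_eq_mul, h0, h3] at e1 e2
  rw [← e1, ← e2]
  ring

theorem add_coe_mem_lattice_iff (x : ℂ) (l : L.lattice) : x + l ∈ L.lattice ↔ x ∈ L.lattice := by
  simpa using (L.lattice.toAddSubgroup.add_mem_cancel_right (y := x) l.2)

/-- Liouville's theorem in `x`: the exponential multipliers of `σ` cancel, so the expression is
periodic; its poles on the lattice are removable, so it is constant; at `x = y` it vanishes because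
`σ(0) = 0`. -/
theorem sigma_sq_mul_weierstrassP_sub_add_eq_zero {x y : ℂ} (hx : x ∉ L.lattice)
    (hy : y ∉ L.lattice) :
    sigma L y ^ 2 * (℘[L] x - ℘[L] y) + sigma L (x + y) * sigma L (x - y) / sigma L x ^ 2 = 0 := by
  classical
  have hσ := differentiable_sigma L
  have hP := differentiable_sigmaProd L
  -- This is the numerator of the polar part over the denominator `σ(x)²`. It vanishes at `0` and is
  -- even, so the double pole and the simple pole disappear together.
  obtain ⟨k, hk, hk'⟩ := exists_eq_sq_mul_of_even
    (f := fun x ↦ sigma L y ^ 2 * sigmaProd L x ^ 2 + sigma L (x + y) * sigma L (x - y))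
    (by fun_prop) (by simp; ring) (fun x ↦ by
      rw [sigmaProd_neg, show -x + y = -(x - y) by ring,
        show -x - y = -(x + y) by ring, sigma_neg, sigma_neg]
      ring)
  -- The continuation across the origin: `℘` without its term `1 / x²`, that term having been
  -- absorbed into `k`.
  set g₀ : ℂ → ℂ := fun x ↦
    sigma L y ^ 2 * (℘[L - (0 : ℂ)] x - ℘[L] y) + k x / sigmaProd L x ^ 2 with hg₀
  set g : ℂ → ℂ := fun x ↦ if x ∈ L.lattice then g₀ 0 else
    sigma L y ^ 2 * (℘[L] x - ℘[L] y) + sigma L (x + y) * sigma L (x - y) / sigma L x ^ 2 with hg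
  have hgg₀ : g =ᶠ[𝓝 0] g₀ := by
    filter_upwards [L.compl_lattice_sdiff_singleton_mem_nhds 0] with x hx
    by_cases h0 : x = 0
    · simp [hg, h0]
    · have hx : x ∉ L.lattice := by simp_all
      have h1 := sigmaProd_ne_zero L hx
      have h2 := L.weierstrassPExcept_add 0 x
      simp only [ZeroMemClass.coe_zero] at h2
      simp only [hg, hg₀, if_neg hx, ← h2]
      have h3 := hk' x
      have : sigma L (x + y) * sigma L (x - y) =
        x ^ 2 * k x - sigma L y ^ 2 * sigmaProd L x ^ 2 := by linear_combination h3
      rw [this, sigma_eq L x]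
      field_simp
      simp
      ring
  have hper : ∀ z (l : L.lattice), g (z + l) = g z := by
    intro z l
    simp only [hg, add_coe_mem_lattice_iff, L.weierstrassP_add_coe]
    split_ifs with hz
    · rfl
    obtain ⟨K, A, hK, h⟩ := exists_sigma_add_coe L l
    rw [show z + l + y = (z + y) + l by ring, show z + l - y = (z - y) + l by ring, h, h, h]
    congr 1
    rw [show A * (z + y) = A * z + A * y by ring, show A * (z - y) = A * z - A * y by ring,
      Complex.exp_add, Complex.exp_sub]
    have h1 := Complex.exp_ne_zero (A * z)
    have h2 := Complex.exp_ne_zero (A * y)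
    field_simp
  have hdiff₀ : DifferentiableAt ℂ g 0 := by
    refine DifferentiableAt.congr_of_eventuallyEq ?_ hgg₀
    have h1 := (L.analyticAt_weierstrassPExcept 0).differentiableAt
    have h2 : sigmaProd L 0 ^ 2 ≠ 0 := by simp
    fun_prop (disch := assumption)
  have hdiff : Differentiable ℂ g := by
    intro x
    by_cases hx : x ∈ L.lattice
    · have e : g = fun z ↦ g (z - x) := by
        ext z
        simpa using hper (z - x) ⟨x, hx⟩
      rw [e]
      exact DifferentiableAt.comp (g := g) (f := fun z ↦ z - x) x (by simpa using hdiff₀)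
        (by fun_prop)
    · have h1 : DifferentiableAt ℂ ℘[L] x := (L.analyticOnNhd_weierstrassP x hx).differentiableAt
      have h2 : sigma L x ^ 2 ≠ 0 := pow_ne_zero _ (sigma_ne_zero L hx)
      have h3 : DifferentiableAt ℂ (fun x ↦ sigma L y ^ 2 * (℘[L] x - ℘[L] y) +
          sigma L (x + y) * sigma L (x - y) / sigma L x ^ 2) x := by
        fun_prop (disch := assumption)
      refine h3.congr_of_eventuallyEq ?_
      filter_upwards [L.isClosed_lattice.isOpen_compl.mem_nhds hx] with z hz
      simp only [hg]
      exact if_neg hz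
  have hconst := hdiff.apply_eq_apply_of_bounded
    (IsZLattice.isCompact_range_of_periodic L.lattice _ hdiff.continuous
      fun z w hw ↦ hper z ⟨w, hw⟩).isBounded x y
  simpa [hg, hx, hy] using hconst

/-- `σ(x + y) σ(x - y) = -σ(x)² σ(y)² (℘(x) - ℘(y))`. -/
theorem sigma_add_mul_sigma_sub {x y : ℂ} (hx : x ∉ L.lattice) (hy : y ∉ L.lattice) :
    sigma L (x + y) * sigma L (x - y) =
      -(sigma L x ^ 2 * sigma L y ^ 2 * (℘[L] x - ℘[L] y)) := by
  have h := sigma_sq_mul_weierstrassP_sub_add_eq_zero L hx hy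
  have h1 := sigma_ne_zero L hx
  field_simp at h
  linear_combination h

theorem dense_compl_lattice : Dense ((L.lattice : Set ℂ)ᶜ) := by
  have : Countable L.lattice := L.latticeEquivProd.toEquiv.countable_iff.mpr inferInstance
  exact Set.Countable.dense_compl ℝ (Set.to_countable _)

/-- The three-term identity of Weierstrass. -/
theorem sigma_three_term (u v w z : ℂ) :
    sigma L (u + v) * sigma L (u - v) * (sigma L (w + z) * sigma L (w - z)) +
      sigma L (u + w) * sigma L (u - w) * (sigma L (z + v) * sigma L (z - v)) +
      sigma L (u + z) * sigma L (u - z) * (sigma L (v + w) * sigma L (v - w)) = 0 := by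
  have hd := dense_compl_lattice L
  have hσ := continuous_sigma L
  -- Off the lattice each product is a difference of `℘` values, and the claim becomes a polynomial
  -- identity in four values of `℘`.
  have key := Continuous.ext_on (hd.prod (hd.prod (hd.prod hd)))
    (f := fun p : ℂ × ℂ × ℂ × ℂ ↦
      sigma L (p.1 + p.2.1) * sigma L (p.1 - p.2.1) *
        (sigma L (p.2.2.1 + p.2.2.2) * sigma L (p.2.2.1 - p.2.2.2)) +
      sigma L (p.1 + p.2.2.1) * sigma L (p.1 - p.2.2.1) *
        (sigma L (p.2.2.2 + p.2.1) * sigma L (p.2.2.2 - p.2.1)) +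
      sigma L (p.1 + p.2.2.2) * sigma L (p.1 - p.2.2.2) *
        (sigma L (p.2.1 + p.2.2.1) * sigma L (p.2.1 - p.2.2.1)))
    (g := fun _ ↦ 0) (by fun_prop) (by fun_prop) (by
      rintro ⟨u, v, w, z⟩ ⟨hu, hv, hw, hz⟩
      simp only [sigma_add_mul_sigma_sub L hu hv, sigma_add_mul_sigma_sub L hu hw,
        sigma_add_mul_sigma_sub L hu hz, sigma_add_mul_sigma_sub L hw hz,
        sigma_add_mul_sigma_sub L hz hv, sigma_add_mul_sigma_sub L hv hw]
      ring)
  exact congrFun key (u, v, w, z)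

theorem sigma_exchange (ξ p q x y : ℂ) :
    sigma L (ξ + p + q) * sigma L (ξ + x + y) * (sigma L (p + y) * sigma L (x + q)) -
      sigma L (ξ + p + y) * sigma L (ξ + x + q) * (sigma L (p + q) * sigma L (x + y)) =
      sigma L ξ * sigma L (ξ + x + y + p + q) * (sigma L (p - x) * sigma L (q - y)) := by
  -- The arguments solve `u + v = ξ + p + q`, `u - v = ξ + x + y`, `w + z = p + y`, `z - w = x + q`.
  have h := sigma_three_term L (ξ + (p + q + x + y) / 2) ((p + q - x - y) / 2)
    ((p + y - x - q) / 2) ((p + q + x + y) / 2)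
  ring_nf at h ⊢
  have e : sigma L (-q - x) = -sigma L (q + x) := by rw [← sigma_neg]; ring_nf
  rw [e] at h
  linear_combination -h

/-- The exchange relation for `Φ` that underlies the elimination of a row and a column of an elliptic
Cauchy matrix. -/
theorem Phi_exchange {ξ x y p q : ℂ} (hξ : ξ ∉ L.lattice) (hxy : x + y ∉ L.lattice)
    (hξxy : ξ + x + y ∉ L.lattice) (hpy : p + y ∉ L.lattice) (hxq : x + q ∉ L.lattice)
    (hpq : p + q ∉ L.lattice) :
    Phi L ξ (p + q) * Phi L ξ (x + y) - Phi L ξ (p + y) * Phi L ξ (x + q) =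
      Phi L ξ (x + y) * Phi L (ξ + x + y) (p + q) *
        ((sigma L (p - x) / sigma L (p + y)) * (sigma L (q - y) / sigma L (x + q))) := by
  have h := sigma_exchange L ξ p q x y
  have h1 := sigma_ne_zero L hξ
  have h2 := sigma_ne_zero L hxy
  have h3 := sigma_ne_zero L hξxy
  have h4 := sigma_ne_zero L hpy
  have h5 := sigma_ne_zero L hxq
  have h6 := sigma_ne_zero L hpq
  simp only [Phi, ← add_assoc] at h ⊢
  field_simp
  linear_combination h

end

/-! ### Bordered determinants and the Desnanot–Jacobi identity. -/

section

open Matrix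

section BorderedDeterminants

variable {n : Type*} [Fintype n] [DecidableEq n]

/-- The matrix `A` bordered by a column `u`, a row `v` and a corner entry `d`. -/
def bordered (A : Matrix n n ℂ) (u v : n → ℂ) (d : ℂ) : Matrix (n ⊕ Unit) (n ⊕ Unit) ℂ :=
  fromBlocks A (of fun i _ ↦ u i) (of fun _ j ↦ v j) (of fun _ _ ↦ d)

/-- Elimination of the border of a bordered matrix. -/
theorem det_bordered (A : Matrix n n ℂ) (u v : n → ℂ) {d : ℂ} (hd : d ≠ 0) :
    (bordered A u v d).det = d * (of fun i j ↦ A i j - u i * v j / d).det := by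
  have e : (of fun _ _ ↦ d : Matrix Unit Unit ℂ) = d • 1 := by
    ext; simp
  have hu : IsUnit (of fun _ _ ↦ d : Matrix Unit Unit ℂ) := by
    rw [e, isUnit_iff_isUnit_det]
    simpa using hd
  let := hu.invertible
  have hinv : ⅟(of fun _ _ ↦ d : Matrix Unit Unit ℂ) = d⁻¹ • 1 := by
    refine invOf_eq_right_inv ?_
    rw [e]
    simp [smul_smul, hd]
  rw [bordered, det_fromBlocks₂₂, hinv]
  congr 1
  · simp [e]
  · congr 1
    ext i j
    simp [mul_apply]
    ring

theorem det_bordered_of_isUnit {A : Matrix n n ℂ} (hA : IsUnit A.det) (u v : n → ℂ) (d : ℂ) :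
    (bordered A u v d).det = A.det * (d - v ⬝ᵥ A⁻¹ *ᵥ u) := by
  let := A.invertibleOfIsUnitDet hA
  rw [bordered, det_fromBlocks₁₁, invOf_eq_nonsing_inv, det_unique (n := Unit)]
  congr 1
  simp only [Matrix.sub_apply, of_apply, mul_apply, dotProduct, mulVec, Finset.mul_sum, Finset.sum_mul,
    mul_assoc]
  rw [Finset.sum_comm]

theorem det_bordered_mul (A : Matrix n n ℂ) (u v : n → ℂ) (d r s : ℂ) :
    (bordered A (fun i ↦ u i * s) (fun j ↦ r * v j) (r * s * d)).det =
      r * s * (bordered A u v d).det := by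
  have e : bordered A (fun i ↦ u i * s) (fun j ↦ r * v j) (r * s * d) =
      of fun i j ↦ Sum.elim (fun _ ↦ 1) (fun _ ↦ r) i *
        (of fun i j ↦ Sum.elim (fun _ ↦ 1) (fun _ ↦ s) j * bordered A u v d i j :
          Matrix (n ⊕ Unit) (n ⊕ Unit) ℂ) i j := by
    ext (i | i) (j | j) <;> simp [bordered] <;> ring
  rw [e, det_mul_column, det_mul_row]
  simp
  ring

theorem det_unit_sum_unit (M : Matrix (Unit ⊕ Unit) (Unit ⊕ Unit) ℂ) :
    M.det = M (.inl ()) (.inl ()) * M (.inr ()) (.inr ()) -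
      M (.inl ()) (.inr ()) * M (.inr ()) (.inl ()) := by
  rw [← det_submatrix_equiv_self (finTwoEquiv.trans Equiv.boolEquivPUnitSumPUnit) M, det_fin_two]
  rfl

/-- The matrix `A` bordered by two columns, two rows and a two by two corner. -/
def doublyBordered (A : Matrix n n ℂ) (u₁ u₂ v₁ v₂ : n → ℂ) (d₁₁ d₁₂ d₂₁ d₂₂ : ℂ) :
    Matrix ((n ⊕ Unit) ⊕ Unit) ((n ⊕ Unit) ⊕ Unit) ℂ :=
  bordered (bordered A u₂ v₂ d₂₂) (Sum.elim u₁ fun _ ↦ d₂₁) (Sum.elim v₁ fun _ ↦ d₁₂) d₁₁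

/-- Elimination of one border of a doubly bordered matrix. -/
theorem det_doublyBordered (A : Matrix n n ℂ) (u₁ u₂ v₁ v₂ : n → ℂ) {d₁₁ : ℂ} (d₁₂ d₂₁ d₂₂ : ℂ)
    (hd : d₁₁ ≠ 0) :
    (doublyBordered A u₁ u₂ v₁ v₂ d₁₁ d₁₂ d₂₁ d₂₂).det =
      d₁₁ * (bordered (of fun i j ↦ A i j - u₁ i * v₁ j / d₁₁) (fun i ↦ u₂ i - u₁ i * d₁₂ / d₁₁)
        (fun j ↦ v₂ j - d₂₁ * v₁ j / d₁₁) (d₂₂ - d₂₁ * d₁₂ / d₁₁)).det := by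
  rw [doublyBordered, det_bordered _ _ _ hd]
  congr 2
  ext (i | i) (j | j) <;> simp [bordered]

/-- Each determinant is `det A` times that of a Schur complement, so the claim is the expansion of a
two by two determinant. -/
theorem det_doublyBordered_mul_det_of_isUnit {A : Matrix n n ℂ} (hA : IsUnit A.det)
    (u₁ u₂ v₁ v₂ : n → ℂ) (d₁₁ d₁₂ d₂₁ d₂₂ : ℂ) :
    (doublyBordered A u₁ u₂ v₁ v₂ d₁₁ d₁₂ d₂₁ d₂₂).det * A.det =
      (bordered A u₁ v₁ d₁₁).det * (bordered A u₂ v₂ d₂₂).det -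
        (bordered A u₂ v₁ d₁₂).det * (bordered A u₁ v₂ d₂₁).det := by
  let := A.invertibleOfIsUnitDet hA
  have e : doublyBordered A u₁ u₂ v₁ v₂ d₁₁ d₁₂ d₂₁ d₂₂ =
      (fromBlocks A (of fun i k ↦ Sum.elim (fun _ ↦ u₂ i) (fun _ ↦ u₁ i) k)
        (of fun k j ↦ Sum.elim (fun _ ↦ v₂ j) (fun _ ↦ v₁ j) k)
        (fromBlocks (of fun _ _ ↦ d₂₂) (of fun _ _ ↦ d₂₁) (of fun _ _ ↦ d₁₂)
          (of fun _ _ ↦ d₁₁))).submatrix (Equiv.sumAssoc n Unit Unit)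
            (Equiv.sumAssoc n Unit Unit) := by
    ext ((i | i) | i) ((j | j) | j) <;> simp [doublyBordered, bordered]
  rw [e, det_submatrix_equiv_self, det_fromBlocks₁₁, det_unit_sum_unit]
  simp only [det_bordered_of_isUnit hA, invOf_eq_nonsing_inv]
  have h (u v : n → ℂ) : v ⬝ᵥ A⁻¹ *ᵥ u = ∑ j, (∑ i, v i * A⁻¹ i j) * u j := by
    simp only [dotProduct, mulVec, Finset.mul_sum, Finset.sum_mul, mul_assoc]
    rw [Finset.sum_comm]
  simp only [h]
  simp [mul_apply]
  ring

/-- The determinant is the characteristic polynomial of `-A` at `t`, with finitely many roots.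
Continuity in `t` then disposes of the invertibility assumption. -/
theorem dense_setOf_isUnit_det_add_smul_one (A : Matrix n n ℂ) :
    Dense {t : ℂ | IsUnit (A + t • (1 : Matrix n n ℂ)).det} := by
  have h : {t : ℂ | IsUnit (A + t • (1 : Matrix n n ℂ)).det} =
      {t : ℂ | (-A).charpoly.IsRoot t}ᶜ := by
    ext t
    simp only [Set.mem_ofPred_eq, Set.mem_compl_iff, Polynomial.IsRoot, eval_charpoly,
      isUnit_iff_ne_zero]
    rw [sub_neg_eq_add, scalar_apply, ← smul_one_eq_diagonal, add_comm]
  rw [h]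
  exact Set.Countable.dense_compl ℝ
    (Polynomial.finite_setOfPred_isRoot (charpoly_monic _).ne_zero).countable

/-- The Desnanot–Jacobi identity. -/
theorem det_doublyBordered_mul_det (A : Matrix n n ℂ) (u₁ u₂ v₁ v₂ : n → ℂ)
    (d₁₁ d₁₂ d₂₁ d₂₂ : ℂ) :
    (doublyBordered A u₁ u₂ v₁ v₂ d₁₁ d₁₂ d₂₁ d₂₂).det * A.det =
      (bordered A u₁ v₁ d₁₁).det * (bordered A u₂ v₂ d₂₂).det -
        (bordered A u₂ v₁ d₁₂).det * (bordered A u₁ v₂ d₂₁).det := by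
  have hA : Continuous fun t : ℂ ↦ A + t • (1 : Matrix n n ℂ) := by fun_prop
  have hB (u v : n → ℂ) (d : ℂ) :
      Continuous fun t : ℂ ↦ bordered (A + t • (1 : Matrix n n ℂ)) u v d :=
    hA.matrix_fromBlocks continuous_const continuous_const continuous_const
  have hD : Continuous fun t : ℂ ↦
      doublyBordered (A + t • (1 : Matrix n n ℂ)) u₁ u₂ v₁ v₂ d₁₁ d₁₂ d₂₁ d₂₂ :=
    (hB _ _ _).matrix_fromBlocks continuous_const continuous_const continuous_const
  have key := Continuous.ext_on (dense_setOf_isUnit_det_add_smul_one A)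
    (hD.matrix_det.mul hA.matrix_det)
    (((hB u₁ v₁ d₁₁).matrix_det.mul (hB u₂ v₂ d₂₂).matrix_det).sub
      ((hB u₂ v₁ d₁₂).matrix_det.mul (hB u₁ v₂ d₂₁).matrix_det))
    fun t ht ↦ det_doublyBordered_mul_det_of_isUnit ht u₁ u₂ v₁ v₂ d₁₁ d₁₂ d₂₁ d₂₂
  simpa using congrFun key 0

/-- Sylvester's identity moves the column factors to the rows, so only the products `s i * t i`
matter. -/
theorem det_one_add_mul_mul_eq (Ψ : n → n → ℂ) (s t : n → ℂ) :
    (1 + of fun i j ↦ s i * t j * Ψ i j : Matrix n n ℂ).det =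
      (1 + of fun i j ↦ s i * t i * Ψ i j : Matrix n n ℂ).det := by
  have h := det_one_add_mul_comm (of fun i j ↦ s i * Ψ i j : Matrix n n ℂ) (diagonal t)
  convert h using 3
  · ext i j
    simp [mul_diagonal]
    ring
  · ext i j
    simp [diagonal_mul]
    ring

end BorderedDeterminants

end

/-! ### Elliptic soliton tau functions and their bilinear relation. -/

section

open Matrix

variable (L : PeriodPair) {N : ℕ} (κ : Fin N → ℂ)

/-- The multiplier `σ(k - x) / σ(k + x)` which the shift by `x` applies to the plane wave with
parameter `k`. -/
def shiftFactor (x k : ℂ) : ℂ := sigma L (k - x) / sigma L (k + x)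

theorem shiftFactor_zero {k : ℂ} (hk : k ∉ L.lattice) : shiftFactor L 0 k = 1 := by
  simp [shiftFactor, sigma_ne_zero L hk]

/-- The function `σ(ξ) det (I + diag(s) Φ_ξ(κ_i + κ_j))`. -/
def solitonTau (ξ : ℂ) (s : Fin N → ℂ) : ℂ :=
  sigma L ξ * (1 + of fun i j ↦ s i * Phi L ξ (κ i + κ j) : Matrix (Fin N) (Fin N) ℂ).det

/-- The matrix `I + (s_i t_j Φ_ξ(κ_i + κ_j))`, bordered by the values of `Φ_ξ` at the parameters
`x` and `y`. -/
def borderedCauchy (ξ : ℂ) (s t : Fin N → ℂ) (x y : ℂ) : Matrix (Fin N ⊕ Unit) (Fin N ⊕ Unit) ℂ :=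
  bordered (1 + of fun i j ↦ s i * t j * Phi L ξ (κ i + κ j)) (fun i ↦ s i * Phi L ξ (κ i + y))
    (fun j ↦ t j * Phi L ξ (x + κ j)) (Phi L ξ (x + y))

variable {κ}

theorem Phi_ne_zero {x y : ℂ} (hx : x ∉ L.lattice) (hy : y ∉ L.lattice) (hxy : x + y ∉ L.lattice) :
    Phi L x y ≠ 0 :=
  div_ne_zero (sigma_ne_zero L hxy) (mul_ne_zero (sigma_ne_zero L hx) (sigma_ne_zero L hy))

/-- `Phi_exchange` in the form of a Schur complement. -/
theorem Phi_sub_mul_div {ξ x y p q : ℂ} (hξ : ξ ∉ L.lattice) (hxy : x + y ∉ L.lattice)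
    (hξxy : ξ + x + y ∉ L.lattice) (hpy : p + y ∉ L.lattice) (hxq : x + q ∉ L.lattice)
    (hpq : p + q ∉ L.lattice) :
    Phi L ξ (p + q) - Phi L ξ (p + y) * Phi L ξ (x + q) / Phi L ξ (x + y) =
      Phi L (ξ + x + y) (p + q) *
        ((sigma L (p - x) / sigma L (p + y)) * (sigma L (q - y) / sigma L (x + q))) := by
  have h := Phi_ne_zero L hξ hxy (by rwa [← add_assoc])
  have := Phi_exchange L hξ hxy hξxy hpy hxq hpq
  rw [eq_comm, ← mul_left_inj' h, sub_mul, div_mul_cancel₀ _ h, this]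
  ring

/-- Elimination of the border replaces `ξ` by `ξ + x + y` through `Phi_sub_mul_div`. The row and
column factors it creates multiply, at equal indices, to the shift factors of `x` and `y`. -/
theorem det_borderedCauchy {ξ x y : ℂ} (s t : Fin N → ℂ) (hκ : ∀ i j, κ i + κ j ∉ L.lattice)
    (hx : ∀ i, x + κ i ∉ L.lattice) (hy : ∀ i, y + κ i ∉ L.lattice) (hξ : ξ ∉ L.lattice)
    (hxy : x + y ∉ L.lattice) (hξxy : ξ + x + y ∉ L.lattice) :
    sigma L ξ * sigma L (x + y) * (borderedCauchy L κ ξ s t x y).det =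
      solitonTau L κ (ξ + x + y)
        (fun i ↦ s i * t i * shiftFactor L x (κ i) * shiftFactor L y (κ i)) := by
  have h := Phi_ne_zero L hξ hxy (by rwa [← add_assoc])
  have h1 := sigma_ne_zero L hξ
  have h2 := sigma_ne_zero L hxy
  rw [borderedCauchy, det_bordered _ _ _ h, solitonTau, ← mul_assoc]
  congr 1
  · simp only [Phi, ← add_assoc]
    field_simp
  have e : (of fun i j ↦ (1 + of fun i j ↦ s i * t j * Phi L ξ (κ i + κ j) :
      Matrix (Fin N) (Fin N) ℂ) i j -
        s i * Phi L ξ (κ i + y) * (t j * Phi L ξ (x + κ j)) / Phi L ξ (x + y)) =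
      1 + of fun i j ↦ (s i * (sigma L (κ i - x) / sigma L (κ i + y))) *
        (t j * (sigma L (κ j - y) / sigma L (x + κ j))) * Phi L (ξ + x + y) (κ i + κ j) := by
    ext i j
    have := Phi_sub_mul_div L hξ hxy hξxy (by rw [add_comm]; exact hy i) (hx j) (hκ i j)
    simp only [of_apply, Matrix.add_apply]
    linear_combination (s i * t j) * this
  rw [e, det_one_add_mul_mul_eq]
  congr 2
  ext i j
  simp only [of_apply, shiftFactor, add_comm x]
  ring

/-- The bilinear relation satisfied by the shifts of `solitonTau` by `a`, `b` and `c`. -/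
theorem solitonTau_bilinear {a b c ξ : ℂ} (s : Fin N → ℂ) (ha : a ∉ L.lattice)
    (hb : b ∉ L.lattice) (hbc : b + c ∉ L.lattice) (hac : a + c ∉ L.lattice)
    (hκ : ∀ i, κ i ∉ L.lattice) (hκκ : ∀ i j, κ i + κ j ∉ L.lattice)
    (haκ : ∀ i, a + κ i ∉ L.lattice) (hbκ : ∀ i, b + κ i ∉ L.lattice)
    (hcκ : ∀ i, c + κ i ∉ L.lattice) (hξ : ξ ∉ L.lattice) (hξa : ξ + a ∉ L.lattice)
    (hξb : ξ + b ∉ L.lattice) (hξac : ξ + a + c ∉ L.lattice) (hξbc : ξ + b + c ∉ L.lattice)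
    (hξabc : ξ + a + b + c ∉ L.lattice) :
    sigma L (a - b) * sigma L c *
        (solitonTau L κ (ξ + a + b + c) (fun i ↦ s i * shiftFactor L a (κ i) *
          shiftFactor L b (κ i) * shiftFactor L c (κ i)) * solitonTau L κ ξ s) =
      sigma L a * sigma L (b + c) *
        (solitonTau L κ (ξ + a + c) (fun i ↦ s i * shiftFactor L a (κ i) *
          shiftFactor L c (κ i)) * solitonTau L κ (ξ + b) (fun i ↦ s i * shiftFactor L b (κ i))) -
      sigma L b * sigma L (a + c) *
        (solitonTau L κ (ξ + b + c) (fun i ↦ s i * shiftFactor L b (κ i) *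
          shiftFactor L c (κ i)) *
            solitonTau L κ (ξ + a) (fun i ↦ s i * shiftFactor L a (κ i))) := by
  have h0κ : ∀ i, 0 + κ i ∉ L.lattice := by simpa using hκ
  set Ψ : Matrix (Fin N) (Fin N) ℂ := of fun i j ↦ s i * Phi L ξ (κ i + κ j) with hΨ
  have hB (x y : ℂ) : borderedCauchy L κ ξ s 1 x y = bordered (1 + Ψ)
      (fun i ↦ s i * Phi L ξ (κ i + y)) (fun j ↦ Phi L ξ (x + κ j)) (Phi L ξ (x + y)) := by
    simp [borderedCauchy, hΨ]
  -- Rows carry `a`, `b` and columns carry `c`, `0`. The parameter `0` shifts nothing, so the four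
  -- single borders give the shifts by `a + c`, `b`, `a`, `b + c`.
  have key := det_doublyBordered_mul_det (1 + Ψ) (fun i ↦ s i * Phi L ξ (κ i + c))
    (fun i ↦ s i * Phi L ξ (κ i + 0)) (fun j ↦ Phi L ξ (a + κ j)) (fun j ↦ Phi L ξ (b + κ j))
    (Phi L ξ (a + c)) (Phi L ξ (a + 0)) (Phi L ξ (b + c)) (Phi L ξ (b + 0))
  simp only [← hB] at key
  have tac := det_borderedCauchy L s 1 hκκ haκ hcκ hξ hac hξac
  have tbc := det_borderedCauchy L s 1 hκκ hbκ hcκ hξ hbc hξbc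
  have ta := det_borderedCauchy L (y := 0) s 1 hκκ haκ h0κ hξ (by simpa) (by simpa)
  have tb := det_borderedCauchy L (y := 0) s 1 hκκ hbκ h0κ hξ (by simpa) (by simpa)
  simp only [add_zero, Pi.one_apply, mul_one, shiftFactor_zero L (hκ _)] at tac tbc ta tb
  have hac' := Phi_ne_zero L hξ hac (by rwa [← add_assoc])
  -- Eliminating the border `(a, c)` leaves a matrix of the same type at `ξ + a + c` with border
  -- `(b, 0)`, which is the triple shift.
  have hdbl : (doublyBordered (1 + Ψ) (fun i ↦ s i * Phi L ξ (κ i + c))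
      (fun i ↦ s i * Phi L ξ (κ i + 0)) (fun j ↦ Phi L ξ (a + κ j)) (fun j ↦ Phi L ξ (b + κ j))
      (Phi L ξ (a + c)) (Phi L ξ (a + 0)) (Phi L ξ (b + c)) (Phi L ξ (b + 0))).det =
      Phi L ξ (a + c) * ((sigma L (b - a) / sigma L (b + c)) * (sigma L (0 - c) / sigma L (a + 0)) *
        (borderedCauchy L κ (ξ + a + c) (fun i ↦ s i * (sigma L (κ i - a) / sigma L (κ i + c)))
          (fun j ↦ sigma L (κ j - c) / sigma L (a + κ j)) b 0).det) := by
    rw [det_doublyBordered _ _ _ _ _ _ _ _ hac', borderedCauchy, ← det_bordered_mul]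
    congr 3
    · ext i j
      have := Phi_sub_mul_div L hξ hac hξac (by rw [add_comm]; exact hcκ i) (haκ j) (hκκ i j)
      simp only [hΨ, of_apply, Matrix.add_apply]
      linear_combination (s i) * this
    · ext i
      have := Phi_sub_mul_div L (q := 0) hξ hac hξac (by rw [add_comm]; exact hcκ i) (by simpa)
        (by simpa using hκ i)
      linear_combination (s i) * this
    · ext j
      have := Phi_sub_mul_div L hξ hac hξac hbc (haκ j) (hbκ j)
      linear_combination this
    · have := Phi_sub_mul_div L (q := 0) hξ hac hξac hbc (by simpa) (by simpa using hb)
      linear_combination this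
  have tabc := det_borderedCauchy L (κ := κ) (ξ := ξ + a + c) (x := b) (y := 0)
    (fun i ↦ s i * (sigma L (κ i - a) / sigma L (κ i + c)))
    (fun j ↦ sigma L (κ j - c) / sigma L (a + κ j)) hκκ hbκ h0κ hξac (by simpa) (by
      rwa [add_zero, add_right_comm])
  have hs : (fun i ↦ s i * (sigma L (κ i - a) / sigma L (κ i + c)) *
      (sigma L (κ i - c) / sigma L (a + κ i)) * shiftFactor L b (κ i) *
        shiftFactor L 0 (κ i)) = fun i ↦ s i * shiftFactor L a (κ i) *
          shiftFactor L b (κ i) * shiftFactor L c (κ i) := by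
    ext i
    rw [shiftFactor_zero L (hκ i)]
    simp only [shiftFactor, add_comm a]
    ring
  rw [hs, add_zero, add_zero, add_right_comm (ξ + a) c b] at tabc
  have t0 : solitonTau L κ ξ s = sigma L ξ * (1 + Ψ).det := rfl
  rw [← tac, ← tbc, ← ta, ← tb, ← tabc, t0]
  rw [hdbl] at key
  have e1 : sigma L (b - a) = -sigma L (a - b) := by rw [← sigma_neg, neg_sub]
  simp only [zero_sub, sigma_neg, add_zero, e1] at key
  have h1 := sigma_ne_zero L ha
  have h2 := sigma_ne_zero L hb
  have h3 := sigma_ne_zero L hbc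
  have h4 := sigma_ne_zero L hac
  have h5 := sigma_ne_zero L hξ
  have h6 : Phi L ξ (a + c) = sigma L (ξ + a + c) / (sigma L ξ * sigma L (a + c)) := by
    rw [Phi, ← add_assoc]
  rw [h6] at key
  generalize (borderedCauchy L κ (ξ + a + c) _ _ b 0).det = D at key ⊢
  field_simp at key
  linear_combination (sigma L ξ * sigma L b) * key

end

/-! ### Gauge transformation and the elliptic dBKP equation. -/

section

variable {L : PeriodPair} {a b c : ℂ}

/-- A single root `α` is chosen freely; the products with `α` dictate `β` and `γ`, and the other
relations follow from `α ^ 2 = A`. -/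
theorem exists_isGaugeRoots (ha : ℘[L] a ≠ 0) (hb : ℘[L] b ≠ 0) (hc : ℘[L] c ≠ 0)
    (hab : Phi L a b ≠ 0) (hbc : Phi L b c ≠ 0) (hca : Phi L c a ≠ 0) :
    ∃ α β γ : ℂ, IsGaugeRoots L a b c α β γ := by
  obtain ⟨α, hα⟩ := IsAlgClosed.exists_pow_nat_eq (gaugeA L a b c) two_pos
  have hα0 : α ≠ 0 := by
    rintro rfl
    rw [zero_pow two_ne_zero, gaugeA] at hα
    have : ℘[L] b * ℘[L] c / (℘[L] a * Phi L b c ^ 2) ≠ 0 := by positivity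
    exact this hα.symm
  rw [gaugeA] at hα
  refine ⟨α, ℘[L] c / (Phi L b c * Phi L c a) / α, ℘[L] b / (Phi L a b * Phi L b c) / α, hα,
    ?_, ?_, ?_, ?_, ?_⟩
  · rw [div_pow, hα, gaugeB]
    field_simp
  · rw [div_pow, hα, gaugeC]
    field_simp
  · field_simp
  · rw [div_mul_div_comm, ← sq, hα]
    field_simp
  · field_simp

theorem IsGaugeRoots.ne_zero {α β γ : ℂ} (h : IsGaugeRoots L a b c α β γ) (ha : ℘[L] a ≠ 0)
    (hc : ℘[L] c ≠ 0) (hab : Phi L a b ≠ 0) (hbc : Phi L b c ≠ 0) (hca : Phi L c a ≠ 0) :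
    α ≠ 0 ∧ β ≠ 0 ∧ γ ≠ 0 := by
  have h1 : α * β ≠ 0 := by rw [h.left_mul_mid]; positivity
  have h2 : β * γ ≠ 0 := by rw [h.mid_mul_right]; positivity
  exact ⟨left_ne_zero_of_mul h1, right_ne_zero_of_mul h1, right_ne_zero_of_mul h2⟩

/-- The gauge transformation relates the two forms of the equation. -/
theorem IsGaugeRoots.dBKPWp_eq_zero_iff {α β γ : ℂ} (h : IsGaugeRoots L a b c α β γ)
    (ha : ℘[L] a ≠ 0) (hc : ℘[L] c ≠ 0) (hab : Phi L a b ≠ 0) (hbc : Phi L b c ≠ 0)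
    (hca : Phi L c a ≠ 0) {τ f : ℤ → ℤ → ℤ → ℂ}
    (hτ : ∀ n m l : ℤ, τ n m l = α ^ (m * l) * β ^ (n * l) * γ ^ (n * m) * f n m l) (n m l : ℤ) :
    dBKPWp L a b c τ n m l = 0 ↔ dBKPPhi L a b c f n m l = 0 := by
  obtain ⟨hα, hβ, hγ⟩ := h.ne_zero ha hc hab hbc hca
  have h1 : ℘[L] c = α * β * (Phi L b c * Phi L c a) := by
    rw [h.left_mul_mid]; field_simp
  have h2 : ℘[L] a = β * γ * (Phi L c a * Phi L a b) := by
    rw [h.mid_mul_right]; field_simp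
  have h3 : ℘[L] b = γ * α * (Phi L a b * Phi L b c) := by
    rw [h.right_mul_left]; field_simp
  -- The triple-shift term carries an extra `αβγ`; in each other term one root comes from the shifts
  -- and the other two from the value of `℘`.
  have key : dBKPWp L a b c τ n m l =
      (α ^ (m * l) * α ^ (m * l) * α ^ m * α ^ l * (β ^ (n * l) * β ^ (n * l) * β ^ n * β ^ l) *
        (γ ^ (n * m) * γ ^ (n * m) * γ ^ n * γ ^ m) * (α * β * γ)) * dBKPPhi L a b c f n m l := by
    simp only [dBKPWp, dBKPPhi, hτ, h1, h2, h3, add_mul, mul_add, one_mul, mul_one,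
      zpow_add₀ hα, zpow_add₀ hβ, zpow_add₀ hγ, zpow_one]
    ring
  rw [key, mul_eq_zero, or_iff_right (by positivity)]

theorem xi_add_one_left (ξ₀ : ℂ) (n m l : ℤ) :
    xi a b c ξ₀ (n + 1) m l = xi a b c ξ₀ n m l + a := by
  simp only [xi]; push_cast; ring

theorem xi_add_one_mid (ξ₀ : ℂ) (n m l : ℤ) :
    xi a b c ξ₀ n (m + 1) l = xi a b c ξ₀ n m l + b := by
  simp only [xi]; push_cast; ring

theorem xi_add_one_right (ξ₀ : ℂ) (n m l : ℤ) :
    xi a b c ξ₀ n m (l + 1) = xi a b c ξ₀ n m l + c := by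
  simp only [xi]; push_cast; ring

theorem Phi_neg_eq {x k : ℂ} (hx : x ∉ L.lattice) (hk : k ∉ L.lattice)
    (hxk : x + k ∉ L.lattice) : Phi L x (-k) = Phi L x k * shiftFactor L x k := by
  have h1 := sigma_ne_zero L hx
  have h2 := sigma_ne_zero L hk
  have h3 := sigma_ne_zero L hxk
  have h4 : sigma L (x - k) = -sigma L (k - x) := by rw [← sigma_neg, neg_sub]
  rw [Phi, Phi, shiftFactor, add_comm k, sigma_neg, ← sub_eq_add_neg, h4]
  field_simp

theorem shiftFactor_ne_zero {x k : ℂ} (hxk : x + k ∉ L.lattice) (hxk' : x - k ∉ L.lattice) :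
    shiftFactor L x k ≠ 0 := by
  refine div_ne_zero (sigma_ne_zero L fun h ↦ hxk' ?_) (sigma_ne_zero L (by rwa [add_comm]))
  simpa using neg_mem h

/-- The product of the plane wave factors `S_i T_i` of the Cauchy matrix. -/
def waveFactor (L : PeriodPair) (a b c : ℂ) {N : ℕ} (κ ρ : Fin N → ℂ) (n m l : ℤ) (i : Fin N) : ℂ :=
  shiftFactor L a (κ i) ^ n * shiftFactor L b (κ i) ^ m * shiftFactor L c (κ i) ^ l * ρ i ^ 2

section Soliton

variable {N : ℕ} {κ : Fin N → ℂ}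

theorem ellipticTau_eq (ρ : Fin N → ℂ) (ξ₀ : ℂ) (ha : a ∉ L.lattice) (hb : b ∉ L.lattice)
    (hc : c ∉ L.lattice) (hκ : ∀ i, κ i ∉ L.lattice) (haκ : ∀ i, a + κ i ∉ L.lattice)
    (hbκ : ∀ i, b + κ i ∉ L.lattice) (hcκ : ∀ i, c + κ i ∉ L.lattice) (n m l : ℤ) :
    ellipticTau L a b c ξ₀ κ ρ n m l =
      solitonTau L κ (xi a b c ξ₀ n m l) (waveFactor L a b c κ ρ n m l) := by
  have h := det_one_add_mul_mul_eq (fun i j ↦ Phi L (xi a b c ξ₀ n m l) (κ i + κ j))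
    (fun i ↦ Phi L a (-κ i) ^ n * Phi L b (-κ i) ^ m * Phi L c (-κ i) ^ l * ρ i)
    (fun j ↦ Phi L a (κ j) ^ (-n) * Phi L b (κ j) ^ (-m) * Phi L c (κ j) ^ (-l) * ρ j)
  rw [ellipticTau, solitonTau]
  congr 1
  convert h using 3
  · ext i j
    simp only [cauchyMatrix, Matrix.of_apply]
    ring
  · ext i j
    simp only [Matrix.of_apply, waveFactor]
    rw [Phi_neg_eq ha (hκ i) (haκ i), Phi_neg_eq hb (hκ i) (hbκ i), Phi_neg_eq hc (hκ i) (hcκ i)]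
    have h1 := Phi_ne_zero L ha (hκ i) (haκ i)
    have h2 := Phi_ne_zero L hb (hκ i) (hbκ i)
    have h3 := Phi_ne_zero L hc (hκ i) (hcκ i)
    simp only [mul_zpow, zpow_neg]
    field_simp

/-- If `Z, Y_a, Y_b, Y_c` satisfy the bilinear relations of `solitonTau_bilinear` for the three
cyclic permutations of `(a, b, c)`, then they satisfy the equation with elliptic coefficients. -/
theorem dBKP_of_bilinear {Z Ya Yb Yc : ℂ} (ha : a ∉ L.lattice) (hb : b ∉ L.lattice)
    (hc : c ∉ L.lattice) (hca : c + a ∉ L.lattice)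
    (h1 : sigma L (a - b) * sigma L c * Z =
      sigma L a * sigma L (b + c) * Yb - sigma L b * sigma L (a + c) * Ya)
    (h2 : sigma L (b - c) * sigma L a * Z =
      sigma L b * sigma L (c + a) * Yc - sigma L c * sigma L (b + a) * Yb)
    (h3 : sigma L (c - a) * sigma L b * Z =
      sigma L c * sigma L (a + b) * Ya - sigma L a * sigma L (c + b) * Yc) :
    Phi L a (-b) * Phi L b (-c) * Phi L c (-a) * Z + Phi L a (-b) * ℘[L] c * Yc +
      Phi L b (-c) * ℘[L] a * Ya + Phi L c (-a) * ℘[L] b * Yb = 0 := by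
  have sa := sigma_ne_zero L ha
  have sb := sigma_ne_zero L hb
  have sc := sigma_ne_zero L hc
  have sca := sigma_ne_zero L hca
  have eab := sigma_add_mul_sigma_sub L ha hb
  have ebc := sigma_add_mul_sigma_sub L hb hc
  have eca := sigma_add_mul_sigma_sub L hc ha
  rw [add_comm a c] at h1
  rw [add_comm b a] at h2
  rw [add_comm c b] at h3
  -- Eliminating `Z` between `h1` and `h2` leaves a relation among `Ya`, `Yb`, `Yc` alone.
  have hAKP : sigma L (a - b) * sigma L c * Yc + sigma L (b - c) * sigma L a * Ya +
      sigma L (c - a) * sigma L b * Yb = 0 := by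
    refine (mul_eq_zero.mp (?_ : sigma L b * sigma L (c + a) * _ = 0)).resolve_left
      (mul_ne_zero sb sca)
    linear_combination sigma L (b - c) * sigma L a * h1 - sigma L (a - b) * sigma L c * h2 +
      sigma L c ^ 2 * Yb * eab + sigma L a ^ 2 * Yb * ebc + sigma L b ^ 2 * Yb * eca
  -- In the symmetrised sum of the three relations, `Yc` gets `2℘(c) - ℘(a) - ℘(b) = 3℘(c) - (℘(a) +
  -- ℘(b) + ℘(c))`, and cyclically. The symmetric part is annihilated by `hAKP`, and the factor `3`
  -- is cancelled.
  have key : sigma L (a - b) * sigma L (b - c) * sigma L (c - a) * Z +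
      sigma L a * sigma L b * sigma L c *
        (sigma L (a - b) * sigma L c * ℘[L] c * Yc + sigma L (b - c) * sigma L a * ℘[L] a * Ya +
          sigma L (c - a) * sigma L b * ℘[L] b * Yb) = 0 := by
    have e3 : (3 : ℂ) * (sigma L a * sigma L b * sigma L c) ≠ 0 := by simp [sa, sb, sc]
    refine (mul_eq_zero.mp (?_ : 3 * (sigma L a * sigma L b * sigma L c) * _ = 0)).resolve_left e3
    linear_combination sigma L b * sigma L c * sigma L (c - a) * sigma L (a - b) * h2 +
      sigma L a * sigma L c * sigma L (a - b) * sigma L (b - c) * h3 +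
      sigma L a * sigma L b * sigma L (b - c) * sigma L (c - a) * h1 +
      sigma L (a - b) * sigma L c * Yc * (sigma L b ^ 2 * eca - sigma L a ^ 2 * ebc) +
      sigma L (c - a) * sigma L b * Yb * (sigma L a ^ 2 * ebc - sigma L c ^ 2 * eab) +
      sigma L (b - c) * sigma L a * Ya * (sigma L c ^ 2 * eab - sigma L b ^ 2 * eca) +
      (℘[L] a + ℘[L] b + ℘[L] c) * (sigma L a * sigma L b * sigma L c) ^ 2 * hAKP
  have e1 (x y : ℂ) : Phi L x (-y) = -(sigma L (x - y) / (sigma L x * sigma L y)) := by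
    rw [Phi, sigma_neg, ← sub_eq_add_neg, mul_neg, div_neg]
  simp only [e1]
  field_simp
  linear_combination -key

theorem dBKPWp_ellipticTau (ρ : Fin N → ℂ) (ξ₀ : ℂ) (ha : a ∉ L.lattice) (hb : b ∉ L.lattice)
    (hc : c ∉ L.lattice) (hab : a + b ∉ L.lattice) (hbc : b + c ∉ L.lattice)
    (hca : c + a ∉ L.lattice) (hκ : ∀ i, κ i ∉ L.lattice) (hκκ : ∀ i j, κ i + κ j ∉ L.lattice)
    (hκabc : ∀ i, a - κ i ∉ L.lattice ∧ a + κ i ∉ L.lattice ∧ b - κ i ∉ L.lattice ∧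
      b + κ i ∉ L.lattice ∧ c - κ i ∉ L.lattice ∧ c + κ i ∉ L.lattice) (n m l : ℤ)
    (hξ : ∀ n' ∈ ({n, n + 1} : Set ℤ), ∀ m' ∈ ({m, m + 1} : Set ℤ), ∀ l' ∈ ({l, l + 1} : Set ℤ),
      xi a b c ξ₀ n' m' l' ∉ L.lattice) :
    dBKPWp L a b c (ellipticTau L a b c ξ₀ κ ρ) n m l = 0 := by
  have haκ i := (hκabc i).2.1
  have hbκ i := (hκabc i).2.2.2.1
  have hcκ i := (hκabc i).2.2.2.2.2
  simp only [Set.mem_insert_iff, Set.mem_singleton_iff, forall_eq_or_imp, forall_eq,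
    xi_add_one_right, xi_add_one_mid, xi_add_one_left] at hξ
  obtain ⟨⟨⟨h000, h001⟩, h010, h011⟩, ⟨h100, h101⟩, h110, h111⟩ := hξ
  have wl (n m l : ℤ) : waveFactor L a b c κ ρ (n + 1) m l =
      fun i ↦ waveFactor L a b c κ ρ n m l i * shiftFactor L a (κ i) := by
    ext i
    rw [waveFactor, zpow_add_one₀ (shiftFactor_ne_zero (haκ i) (hκabc i).1), waveFactor]
    ring
  have wm (n m l : ℤ) : waveFactor L a b c κ ρ n (m + 1) l =
      fun i ↦ waveFactor L a b c κ ρ n m l i * shiftFactor L b (κ i) := by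
    ext i
    rw [waveFactor, zpow_add_one₀ (shiftFactor_ne_zero (hbκ i) (hκabc i).2.2.1), waveFactor]
    ring
  have wr (n m l : ℤ) : waveFactor L a b c κ ρ n m (l + 1) =
      fun i ↦ waveFactor L a b c κ ρ n m l i * shiftFactor L c (κ i) := by
    ext i
    rw [waveFactor, zpow_add_one₀ (shiftFactor_ne_zero (hcκ i) (hκabc i).2.2.2.2.1), waveFactor]
    ring
  -- Unfolding the shifts in the order `l`, `m`, `n` leaves the plane-wave factors ordered as `a`,
  -- `b`, `c`.
  simp only [dBKPWp, ellipticTau_eq ρ ξ₀ ha hb hc hκ haκ hbκ hcκ, xi_add_one_right, xi_add_one_mid,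
    xi_add_one_left, wr]
  simp only [wm]
  simp only [wl]
  set ξ := xi a b c ξ₀ n m l
  set s := waveFactor L a b c κ ρ n m l
  have e2 (x y : ℂ) : solitonTau L κ (ξ + x + y)
      (fun i ↦ s i * shiftFactor L x (κ i) * shiftFactor L y (κ i)) = solitonTau L κ (ξ + y + x)
      (fun i ↦ s i * shiftFactor L y (κ i) * shiftFactor L x (κ i)) := by
    rw [add_right_comm]
    simp only [mul_right_comm]
  have e3 (x y z : ℂ) : solitonTau L κ (ξ + x + y + z)
      (fun i ↦ s i * shiftFactor L x (κ i) * shiftFactor L y (κ i) * shiftFactor L z (κ i)) =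
      solitonTau L κ (ξ + y + z + x)
      (fun i ↦ s i * shiftFactor L y (κ i) * shiftFactor L z (κ i) * shiftFactor L x (κ i)) := by
    congr 1
    · ring
    · ext i; ring
  have E1 := solitonTau_bilinear L s ha hb hbc (by rwa [add_comm]) hκ hκκ haκ hbκ hcκ
    h000 h100 h010 h101 h011 h111
  have E2 := solitonTau_bilinear L s hb hc hca (by rwa [add_comm]) hκ hκκ hbκ hcκ haκ
    h000 h010 h001 (by rwa [add_right_comm]) (by rwa [add_right_comm])
    (by rwa [add_right_comm, add_right_comm ξ])
  have E3 := solitonTau_bilinear L s hc ha hab (by rwa [add_comm]) hκ hκκ hcκ haκ hbκ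
    h000 h001 h100 (by rwa [add_right_comm]) h110
    (by rwa [add_right_comm ξ, add_right_comm])
  rw [← e3 a b c, e2 b a, e2 c a] at E2
  rw [e3 c a b, e2 c b] at E3
  exact dBKP_of_bilinear ha hb hc hca E1 E2 E3

end Soliton

end

end EllipticBKP

end

theorem theorem8 (L : PeriodPair) (a b c : ℂ)
    (ha : a ∉ L.lattice) (hb : b ∉ L.lattice) (hc : c ∉ L.lattice)
    (hab : a + b ∉ L.lattice) (hbc : b + c ∉ L.lattice) (hca : c + a ∉ L.lattice)
    (hwa : PeriodPair.weierstrassP L a ≠ 0) (hwb : PeriodPair.weierstrassP L b ≠ 0)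
    (hwc : PeriodPair.weierstrassP L c ≠ 0) :
    (∃ α β γ : ℂ, EllipticBKP.IsGaugeRoots L a b c α β γ) ∧
    ∀ α β γ : ℂ, EllipticBKP.IsGaugeRoots L a b c α β γ →
      (∀ τ f : ℤ → ℤ → ℤ → ℂ,
        (∀ n m l : ℤ, τ n m l = α ^ (m * l) * β ^ (n * l) * γ ^ (n * m) * f n m l) →
        ∀ n m l : ℤ,
          EllipticBKP.dBKPWp L a b c τ n m l = 0 ↔ EllipticBKP.dBKPPhi L a b c f n m l = 0) ∧
      (∀ (N : ℕ) (κ ρ : Fin N → ℂ) (ξ₀ : ℂ),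
        (∀ i, κ i ∉ L.lattice) →
        (∀ i j, κ i + κ j ∉ L.lattice) →
        (∀ i, a - κ i ∉ L.lattice ∧ a + κ i ∉ L.lattice ∧ b - κ i ∉ L.lattice ∧
          b + κ i ∉ L.lattice ∧ c - κ i ∉ L.lattice ∧ c + κ i ∉ L.lattice) →
        ∀ f : ℤ → ℤ → ℤ → ℂ,
          (∀ n m l : ℤ, f n m l = α ^ (-(m * l)) * β ^ (-(n * l)) * γ ^ (-(n * m)) *
            EllipticBKP.ellipticTau L a b c ξ₀ κ ρ n m l) →
          ∀ n m l : ℤ,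
            (∀ n' ∈ ({n, n + 1} : Set ℤ), ∀ m' ∈ ({m, m + 1} : Set ℤ),
              ∀ l' ∈ ({l, l + 1} : Set ℤ), EllipticBKP.xi a b c ξ₀ n' m' l' ∉ L.lattice) →
            EllipticBKP.dBKPPhi L a b c f n m l = 0) := by
  obtain hab' := EllipticBKP.Phi_ne_zero L ha hb hab
  obtain hbc' := EllipticBKP.Phi_ne_zero L hb hc hbc
  obtain hca' := EllipticBKP.Phi_ne_zero L hc ha hca
  refine ⟨EllipticBKP.exists_isGaugeRoots hwa hwb hwc hab' hbc' hca', fun α β γ h ↦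
    ⟨fun τ f hτ ↦ h.dBKPWp_eq_zero_iff hwa hwc hab' hbc' hca' hτ, ?_⟩⟩
  intro N κ ρ ξ₀ hκ hκκ hκabc f hf n m l hξ
  obtain ⟨hα, hβ, hγ⟩ := h.ne_zero hwa hwc hab' hbc' hca'
  -- The gauge equivalence is applied with `ellipticTau` as `τ`, since `f` is its inverse gauge
  -- transform.
  refine (h.dBKPWp_eq_zero_iff hwa hwc hab' hbc' hca' (fun n m l ↦ ?_) n m l).mp
    (EllipticBKP.dBKPWp_ellipticTau ρ ξ₀ ha hb hc hab hbc hca hκ hκκ hκabc n m l hξ)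
  rw [hf, zpow_neg, zpow_neg, zpow_neg]
  field_simp
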